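/- Let $X$ be a non-empty topological space, $E$ a real Hausdorff topological vector space and $\Lambda\subseteq E$ a convex set. Let $f:X\times\Lambda\to\mathbb{R}$ be such that, for each $\lambda\in\Lambda$, the function $f(\cdot,\lambda)$ is lower semicontinuous and inf-compact (that is, for each $r\in\mathbb{R}$ the set $\{x\in X: f(x,\lambda)\le r\}$ is compact) and, for each $x\in X$, the function $f(x,\cdot)$ is upper semicontinuous and concave in $\Lambda$. Assume that $$\sup_{\lambda\in\Lambda}\inf_{x\in X}f(x,\lambda)<\inf_{x\in X}\sup_{\lambda\in\Lambda}f(x,\lambda),$$ where suprema and infima are taken in $[-\infty,+\infty]$. Then there exists $\lambda^*\in\Lambda$ such that the function $f(\cdot,\lambda^*)$ has at least two global minima, that is, there are two distinct points of $X$ at each of which $f(\cdot,\lambda^*)$ attains its minimum over $X$. -/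

import Mathlib

/-- A real-valued function on a topological space is inf-compact if all of its sublevel sets
`{x | ψ x ≤ r}`, with `r` real, are compact. -/
def InfCompact {U : Type*} [TopologicalSpace U] (ψ : U → ℝ) : Prop :=
  ∀ r : ℝ, IsCompact {x : U | ψ x ≤ r}

/-- The point `x` is a global minimum (point) of `ψ`. -/
def IsGlobalMin {U : Type*} (ψ : U → ℝ) (x : U) : Prop :=
  ∀ y : U, ψ x ≤ ψ y

/-! Suppose all minimum points are unique, and fix `c` strictly between the two sides. By
inf-compactness, a finite `S ⊆ Λ` already satisfies `max_{l ∈ S} f x l > c` for every `x`. On the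
compact hull of `S`, the upper semicontinuous `l ↦ min f(·, l)` is maximal at some `k`, with minimum
point `x` and `f x k < c`. Perturbing `k` towards `l ∈ S` and using concavity,
`exists_isGlobalMin_le_of_forall_segment` yields a minimum point `y` of `f(·, k)` with `f y l ≤ f x
k`. Uniqueness gives `y = x` for all `l ∈ S`, a contradiction. -/

/-- A lower semicontinuous inf-compact function on a nonempty space attains its minimum. -/
theorem InfCompact.exists_isGlobalMin {X : Type*} [TopologicalSpace X] [Nonempty X] {ψ : X → ℝ}
    (hψ : LowerSemicontinuous ψ) (hc : InfCompact ψ) : ∃ x, IsGlobalMin ψ x := by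
  obtain ⟨x₀⟩ := ‹Nonempty X›
  obtain ⟨x, hx, hmin⟩ := (hψ.lowerSemicontinuousOn {x | ψ x ≤ ψ x₀}).exists_isMinOn
    ⟨x₀, le_refl (ψ x₀)⟩ (hc (ψ x₀))
  refine ⟨x, fun y => ?_⟩
  by_cases hy : ψ y ≤ ψ x₀
  · exact hmin hy
  · exact le_trans hx (not_le.1 hy).le

/-- Let `m` be a lower bound of `p`, and let `q` be bounded below. If each `(1 - t) p + t q` with
`0 < t < 1` takes a value at most `m`, then some minimum point of `p` satisfies `q ≤ m`. -/
theorem exists_isGlobalMin_le_of_forall_segment {X : Type*} [TopologicalSpace X]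
    {p q : X → ℝ} (hp : LowerSemicontinuous p) (hq : InfCompact q) {m b : ℝ}
    (hm : ∀ x, m ≤ p x) (hb : ∀ x, b ≤ q x)
    (h : ∀ t : ℝ, 0 < t → t < 1 → ∃ x, (1 - t) * p x + t * q x ≤ m) :
    ∃ y, IsGlobalMin p y ∧ q y ≤ m := by
  have key : ∀ t : ℝ, 0 < t → t < 1 → ∃ x, q x ≤ m ∧ (1 - t) * p x ≤ m - t * b := by
    intro t ht ht1
    obtain ⟨x, hx⟩ := h t ht ht1
    have h1 : (1 - t) * m ≤ (1 - t) * p x := mul_le_mul_of_nonneg_left (hm x) (by linarith)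
    have h2 : t * b ≤ t * q x := mul_le_mul_of_nonneg_left (hb x) ht.le
    exact ⟨x, le_of_mul_le_mul_left (by linarith) ht, by linarith⟩
  obtain ⟨x₁, hx₁, -⟩ := key (1 / 2) (by norm_num) (by norm_num)
  obtain ⟨y, hy, hmin⟩ := (hp.lowerSemicontinuousOn {x | q x ≤ m}).exists_isMinOn
    ⟨x₁, hx₁⟩ (hq m)
  -- Letting `t → 0` removes the error `t * b`; `y` does not depend on `t`.
  have hbound : ∀ t ∈ Set.Ioo (0 : ℝ) 1, (1 - t) * p y ≤ m - t * b := by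
    rintro t ⟨ht, ht1⟩
    obtain ⟨x, hx, hx'⟩ := key t ht ht1
    exact (mul_le_mul_of_nonneg_left (hmin hx) (by linarith)).trans hx'
  have hlim : p y ≤ m := by
    have := ContinuousWithinAt.closure_le (s := Set.Ioo (0 : ℝ) 1) (x := 0)
      (f := fun t => (1 - t) * p y) (g := fun t => m - t * b)
      (by rw [closure_Ioo (by norm_num)]; simp) (by fun_prop) (by fun_prop) hbound
    simpa using this
  exact ⟨y, fun z => hlim.trans (hm z), hy⟩

/-- The function `f : X × Λ → ℝ` is given by a function on `X × E` of which only the values on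
`X × Λ` are used. Suprema and infima are taken in the extended reals. -/
theorem theorem3p2 {X : Type*} [TopologicalSpace X] [Nonempty X]
    {E : Type*} [AddCommGroup E] [Module ℝ E] [TopologicalSpace E] [IsTopologicalAddGroup E]
    [ContinuousSMul ℝ E] [T2Space E]
    (Λ : Set E) (hΛ : Convex ℝ Λ) (f : X → E → ℝ)
    (hlsc : ∀ l ∈ Λ, LowerSemicontinuous (fun x => f x l))
    (hinf : ∀ l ∈ Λ, InfCompact (fun x => f x l))
    (husc : ∀ x, UpperSemicontinuousOn (f x) Λ)
    (hconc : ∀ x, ConcaveOn ℝ Λ (f x))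
    (hlt : (⨆ l ∈ Λ, ⨅ x : X, (f x l : EReal)) < ⨅ x : X, ⨆ l ∈ Λ, (f x l : EReal)) :
    ∃ l ∈ Λ, ∃ x₁ x₂ : X, x₁ ≠ x₂ ∧
      IsGlobalMin (fun x => f x l) x₁ ∧ IsGlobalMin (fun x => f x l) x₂ := by
  by_contra hcon
  have huniq : ∀ l ∈ Λ, ∀ x₁ x₂ : X, IsGlobalMin (fun x => f x l) x₁ →
      IsGlobalMin (fun x => f x l) x₂ → x₁ = x₂ := fun l hl x₁ x₂ h₁ h₂ =>
    by_contra fun hne => hcon ⟨l, hl, x₁, x₂, hne, h₁, h₂⟩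
  have hex : ∀ l ∈ Λ, ∃ x, IsGlobalMin (fun x => f x l) x := fun l hl =>
    InfCompact.exists_isGlobalMin (hlsc l hl) (hinf l hl)
  obtain ⟨c, hc₁, hc₂⟩ := EReal.lt_iff_exists_real_btwn.1 hlt
  have hlow : ∀ l ∈ Λ, ∃ x, f x l < c := by
    intro l hl
    have h : (⨅ x : X, (f x l : EReal)) < c :=
      (le_iSup₂ (f := fun l (_ : l ∈ Λ) => ⨅ x : X, (f x l : EReal)) l hl).trans_lt hc₁
    obtain ⟨x, hx⟩ := iInf_lt_iff.1 h
    exact ⟨x, EReal.coe_lt_coe_iff.1 hx⟩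
  have hhigh : ∀ x, ∃ l ∈ Λ, c < f x l := by
    intro x
    have h := hc₂.trans_le (iInf_le (fun x : X => ⨆ l ∈ Λ, (f x l : EReal)) x)
    obtain ⟨l, hl, hx⟩ := lt_biSup_iff.1 h
    exact ⟨l, hl, EReal.coe_lt_coe_iff.1 hx⟩
  obtain ⟨l₀, hl₀, -⟩ := hhigh (Classical.arbitrary X)
  -- Finitely many parameters suffice, by compactness.
  obtain ⟨t, ht⟩ := (hinf l₀ hl₀ c).elim_finite_subfamily_closed
    (fun l : Λ => {x | f x l ≤ c}) (fun l => (hlsc l l.2).isClosed_preimage c) (by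
      refine Set.eq_empty_of_forall_notMem fun x hx => ?_
      obtain ⟨l, hl, hlx⟩ := hhigh x
      exact absurd (Set.mem_iInter.1 hx.2 ⟨l, hl⟩) (not_le.2 hlx))
  -- Including `l₀` makes the hull nonempty and later places `x` in the compact sublevel set.
  set S : Set E := insert l₀ (Subtype.val '' (t : Set Λ))
  have hSfin : S.Finite := (t.finite_toSet.image _).insert _
  have hSΛ : S ⊆ Λ := Set.insert_subset hl₀ (Subtype.coe_image_subset _ _)
  have hKΛ : convexHull ℝ S ⊆ Λ := convexHull_min hSΛ hΛ
  have hbdd : ∀ l ∈ Λ, BddBelow (Set.range fun x => f x l) := fun l hl =>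
    let ⟨x, hx⟩ := hex l hl
    ⟨f x l, Set.forall_mem_range.2 hx⟩
  have hg : UpperSemicontinuousOn (fun l => ⨅ x, f x l) (convexHull ℝ S) :=
    upperSemicontinuousOn_ciInf (fun l hl => hbdd l (hKΛ hl)) fun x => (husc x).mono hKΛ
  obtain ⟨k, hk, hmax⟩ := hg.exists_isMaxOn
    ⟨l₀, subset_convexHull ℝ S (Set.mem_insert _ _)⟩ (hSfin.isCompact_convexHull (𝕜 := ℝ))
  have hkΛ := hKΛ hk
  obtain ⟨x, hx⟩ := hex k hkΛ
  obtain ⟨z, hz⟩ := hlow k hkΛ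
  have hxc : f x k < c := (hx z).trans_lt hz
  have hall : ∀ l ∈ S, f x l ≤ f x k := by
    intro l hlS
    have hl := subset_convexHull ℝ S hlS
    obtain ⟨w, hw⟩ := hex l (hSΛ hlS)
    obtain ⟨y, hy, hyl⟩ := exists_isGlobalMin_le_of_forall_segment (hlsc k hkΛ)
      (hinf l (hSΛ hlS)) hx hw (fun s hs hs1 => by
        have hseg : (1 - s) • k + s • l ∈ convexHull ℝ S :=
          convex_convexHull ℝ S hk hl (by linarith) hs.le (by ring)
        obtain ⟨v, hv⟩ := hex _ (hKΛ hseg)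
        refine ⟨v, ?_⟩
        calc (1 - s) * f v k + s * f v l ≤ f v ((1 - s) • k + s • l) :=
              (hconc v).2 hkΛ (hSΛ hlS) (by linarith) hs.le (by ring)
          _ ≤ ⨅ u, f u ((1 - s) • k + s • l) := le_ciInf hv
          _ ≤ ⨅ u, f u k := hmax hseg
          _ ≤ f x k := ciInf_le (hbdd k hkΛ) x)
    rwa [huniq k hkΛ y x hy hx] at hyl
  have hmem : x ∈ {x | f x l₀ ≤ c} ∩ ⋂ l ∈ t, {x | f x (l : Λ) ≤ c} := by
    refine ⟨(hall l₀ (Set.mem_insert _ _)).trans hxc.le, Set.mem_iInter₂.2 fun l hl => ?_⟩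
    exact (hall l (Set.mem_insert_of_mem _ (Set.mem_image_of_mem _ hl))).trans hxc.le
  exact Set.notMem_empty x (ht ▸ hmem)
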